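/- A machine has status $X(t)\in\{0,1,2\}$ ($0$ = free, $1$ = busy with an internal job, $2$ = processing an external job), and a resource allocator keeps an estimate $\hat X(t)$ of it; initially $X(0)=\hat X(0)=0$. Let $\alpha,\beta,\gamma,\lambda,\mu>0$. While $X=0$, internal jobs arrive at rate $\alpha$ and change $X$ to $1$; while $X=1$, the internal job is completed at rate $\beta$ and $X$ becomes $0$; while $X=2$, the external job is completed at rate $\gamma$ and $X$ becomes $0$. The allocator samples the machine at rate $\mu$, whereupon $\hat X$ becomes equal to $X$. External job requests arrive at the allocator at rate $\lambda$; a request is rejected (with no change of state) if $\hat X\neq 0$ and accepted if $\hat X=0$. An accepted request makes $X=2$ if $X=0$, and is lost if $X\neq 0$; in both cases $\hat X$ is then set to the resulting status $X$. All events are Markovian, so that $Y(t)=(X(t),\hat X(t))$ is a continuous-time Markov chain on $S=\{0,1\}\times\{0,1\}\cup\{0,1,2\}\times\{2\}$; let $Q$ be its generator matrix. Let $N_A(T)$ and $N_R(T)$ be the numbers of requests accepted and rejected up to time $T$, $N_{FA}(T)$ the number of requests accepted while $X\ne 0$, and $N_{FR}(T)$ the number of requests rejected while $X=0$. Put $$\mathrm{FAR}=\mathbb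 E\Big[\limsup_{T\to\infty}\frac{N_{FA}(T)}{N_A(T)}\Big],\qquad \mathrm{FRR}=\mathbb E\Big[\limsup_{T\to\infty}\frac{N_{FR}(T)}{N_R(T)}\Big].$$ Then $Y$ has a unique stationary distribution $\pi=(\pi_{ij})_{(i,j)\in S}$ (the unique probability vector with $\pi Q=0$), and with $\kappa=\lambda+\alpha+\beta$ and $\tilde\beta=\lambda\beta(\lambda+\beta)+\gamma(\lambda\beta+\lambda\alpha+\alpha\kappa)$, $$\mathrm{FAR}=\frac{\pi_{10}}{\pi_{10}+\pi_{00}}=\frac{\alpha}{\mu+\kappa},$$ $$\mathrm{FRR}=\frac{\pi_{02}+\pi_{01}}{\pi_{02}+\pi_{01}+\pi_{12}+\pi_{11}+\pi_{22}}=\frac{\gamma\beta\,(\mu(\lambda+\alpha)+\lambda\kappa)}{(\alpha\gamma+\lambda\beta)\mu^2+\tilde\beta\mu+\gamma\lambda(\beta+\alpha)\kappa}.$$ -/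

import Mathlib

open MeasureTheory ProbabilityTheory Filter

noncomputable section

/-- The transition rates of a single Markov machine with its resource allocator. -/
structure MarkovMachine where
  /-- arrival rate of internal jobs (while the machine is free) -/
  α : ℝ
  /-- completion rate of internal jobs -/
  β : ℝ
  /-- completion rate of external jobs -/
  γ : ℝ
  /-- arrival rate of external job requests at the allocator -/
  lam : ℝ
  /-- rate at which the allocator samples the machine -/
  μ : ℝ
  α_pos : 0 < α
  β_pos : 0 < β
  γ_pos : 0 < γ
  lam_pos : 0 < lam
  μ_pos : 0 < μ

namespace MarkovMachine

/-- The status of the machine: free (`0`), busy with an internal job (`1`), or processing an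
external job (`2`). -/
inductive Status
  | free
  | busy
  | external
  deriving DecidableEq

instance : Fintype Status :=
  ⟨{.free, .busy, .external}, fun x => by cases x <;> simp⟩

/-- The events: arrival and completion of an internal job, completion of an external job,
sampling of the machine, and arrival of an external job request at the allocator. -/
inductive Event
  | internalArrival
  | internalCompletion
  | externalCompletion
  | sample
  | request
  deriving DecidableEq

instance : Fintype Event :=
  ⟨{.internalArrival, .internalCompletion, .externalCompletion, .sample, .request}, fun x => by cases x <;> simp⟩

/-- The seven-element state space `{0,1} × {0,1} ∪ {0,1,2} × {2}`: pairs (actual status, estimate)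
such that an external job is in progress only if the estimate is `external`. -/
abbrev State : Type :=
  {y : Status × Status // y.1 = Status.external → y.2 = Status.external}

/-- The status `X` of the machine in a state. -/
def State.machine (y : State) : Status := y.1.1

/-- The allocator's estimate of the status in a state. -/
def State.estimate (y : State) : Status := y.1.2

instance : MeasurableSpace Event := ⊤
instance : MeasurableSpace State := ⊤
instance : DiscreteMeasurableSpace Event := ⟨fun _ => trivial⟩
instance : DiscreteMeasurableSpace State := ⟨fun _ => trivial⟩

/-- The effect of an event on the pair (status, estimate). A sample sets the estimate to the actual
status. A request is rejected, without effect, unless the estimate is `free`; if it is `free`, the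
request is assigned to the machine, which starts processing it if it is free (otherwise the job is
lost), and the allocator learns the resulting status. -/
def movePair : Status × Status → Event → Status × Status
  | (.free, e), .internalArrival => (.busy, e)
  | (.busy, e), .internalCompletion => (.free, e)
  | (.external, e), .externalCompletion => (.free, e)
  | (x, _), .sample => (x, x)
  | (.free, .free), .request => (.external, .external)
  | (x, .free), .request => (x, x)
  | y, _ => y

lemma movePair_mem (y : State) (e : Event) :
    (movePair y.1 e).1 = Status.external → (movePair y.1 e).2 = Status.external := by
  revert y e
  decide

/-- The state after an event. -/
def move (y : State) (e : Event) : State := ⟨movePair y.1 e, movePair_mem y e⟩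

/-- The initial state `(0, 0)`: the machine is free and is estimated to be free. -/
def initial : State := ⟨(Status.free, Status.free), by decide⟩

variable (M : MarkovMachine)

/-- The rate at which an event occurs in a state. -/
def rate (y : State) : Event → ℝ
  | .internalArrival => if y.machine = Status.free then M.α else 0
  | .internalCompletion => if y.machine = Status.busy then M.β else 0
  | .externalCompletion => if y.machine = Status.external then M.γ else 0
  | .sample => M.μ
  | .request => M.lam

/-- The total rate of events in a state, including those events that do not change the state. -/
def totalRate (y : State) : ℝ := ∑ e, M.rate y e

/-! ### Stationary distribution -/

/-- The generator matrix of the continuous-time chain `Y = (X, estimate)`. -/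
def generator : Matrix State State ℝ := fun i j =>
  if i = j then -∑ k ∈ Finset.univ.erase i, ∑ e, (if move i e = k then M.rate i e else 0)
  else ∑ e, (if move i e = j then M.rate i e else 0)

/-- `π` is a probability vector with `π Q = 0`. -/
def IsStationary (π : State → ℝ) : Prop :=
  (∀ y, 0 ≤ π y) ∧ ∑ y, π y = 1 ∧ Matrix.vecMul π M.generator = 0

/-! ### The process

The process is given by its steps: the state before the event, the event, and the time spent
waiting for it. -/

/-- One step: the current state, the event that occurs next, and the waiting time for it. -/
abbrev Step : Type := State × Event × ℝ

lemma rate_nonneg (y : State) (e : Event) : 0 ≤ M.rate y e := by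
  have h1 := M.α_pos
  have h2 := M.β_pos
  have h3 := M.γ_pos
  have h4 := M.lam_pos
  have h5 := M.μ_pos
  cases e <;> simp only [rate] <;> positivity

lemma totalRate_pos (y : State) : 0 < M.totalRate y :=
  Finset.sum_pos' (fun e _ => M.rate_nonneg y e) ⟨Event.request, Finset.mem_univ _, M.lam_pos⟩

/-- In state `y` the next event is `e` with probability `rate y e / totalRate y`. -/
def eventLaw (y : State) : Measure Event :=
  ∑ e, ENNReal.ofReal (M.rate y e / M.totalRate y) • Measure.dirac e

instance (y : State) : IsProbabilityMeasure (M.eventLaw y) := by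
  constructor
  have h : ∑ e, M.rate y e / M.totalRate y = 1 := by
    rw [← Finset.sum_div]
    exact div_self (M.totalRate_pos y).ne'
  simp only [eventLaw, Measure.coe_finsetSum, Finset.sum_apply, Measure.smul_apply,
    measure_univ, smul_eq_mul, mul_one]
  rw [← ENNReal.ofReal_sum_of_nonneg, h, ENNReal.ofReal_one]
  exact fun e _ => div_nonneg (M.rate_nonneg y e) (M.totalRate_pos y).le

instance (y : State) : IsProbabilityMeasure (expMeasure (M.totalRate y)) :=
  isProbabilityMeasure_expMeasure (M.totalRate_pos y)

/-- The law of the step made from state `y`: the event and the waiting time are independent, and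
the waiting time is exponential with parameter `totalRate y`. -/
def stepLaw (y : State) : Measure Step :=
  (Measure.dirac y).prod ((M.eventLaw y).prod (expMeasure (M.totalRate y)))

instance (y : State) : IsProbabilityMeasure (M.stepLaw y) := by
  unfold stepLaw
  infer_instance

/-- The law of the next step as a Markov kernel from the current state. -/
def stepKernel : Kernel State Step where
  toFun := M.stepLaw
  measurable' := measurable_of_countable _

instance : IsMarkovKernel M.stepKernel :=
  ⟨fun y => inferInstanceAs (IsProbabilityMeasure (M.stepLaw y))⟩

/-- The state reached by the last of the steps `0, …, n`. -/
def nextState (n : ℕ) (h : Finset.Iic n → Step) : State :=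
  move (h ⟨n, Finset.mem_Iic.2 le_rfl⟩).1 (h ⟨n, Finset.mem_Iic.2 le_rfl⟩).2.1

lemma measurable_nextState (n : ℕ) : Measurable (nextState n) := by
  have h : Measurable fun p : State × Event => move p.1 p.2 := measurable_of_countable _
  have h' : Measurable fun s : Step => (s.1, s.2.1) := by fun_prop
  exact (h.comp h').comp (measurable_pi_apply _)

/-- The law of step `n + 1` given the steps `0, …, n`. -/
def historyKernel (n : ℕ) : Kernel (Finset.Iic n → Step) Step :=
  M.stepKernel.comap (nextState n) (measurable_nextState n)

instance (n : ℕ) : IsMarkovKernel (M.historyKernel n) := by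
  unfold historyKernel
  infer_instance

/-- The law of the whole process started in state `(0, 0)`. -/
def processLaw : Measure (ℕ → Step) :=
  Kernel.trajMeasure (X := fun _ => Step) (M.stepLaw initial) M.historyKernel

/-! ### Counting accepted and rejected requests -/

/-- The time at which the event of step `n` occurs. -/
def eventTime (ω : ℕ → Step) (n : ℕ) : ℝ := ∑ k ∈ Finset.range (n + 1), (ω k).2.2

/-- The number of external job requests up to time `T` that arrive while the state is in `A`. -/
def requestCount (A : Set State) (ω : ℕ → Step) (T : ℝ) : ℝ :=
  ({n : ℕ | eventTime ω n ≤ T ∧ (ω n).2.1 = Event.request ∧ (ω n).1 ∈ A}.ncard : ℝ)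

/-- The states in which the allocator accepts requests. -/
def acceptStates : Set State := {y | y.estimate = Status.free}

/-- The states in which the allocator accepts requests although the machine is not free. -/
def falseAcceptStates : Set State := {y | y.estimate = Status.free ∧ y.machine ≠ Status.free}

/-- The states in which the allocator rejects requests. -/
def rejectStates : Set State := {y | y.estimate ≠ Status.free}

/-- The states in which the allocator rejects requests although the machine is free. -/
def falseRejectStates : Set State := {y | y.estimate ≠ Status.free ∧ y.machine = Status.free}

/-- The false acceptance ratio: the expectation of the upper limit, as `T → ∞`, of the number of
false acceptances up to time `T` over the number of acceptances up to time `T`. -/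
def FAR : ℝ :=
  ∫ ω, limsup (fun T : ℝ =>
    requestCount falseAcceptStates ω T / requestCount acceptStates ω T) atTop ∂M.processLaw

/-- The false rejection ratio: the expectation of the upper limit, as `T → ∞`, of the number of
false rejections up to time `T` over the number of rejections up to time `T`. -/
def FRR : ℝ :=
  ∫ ω, limsup (fun T : ℝ =>
    requestCount falseRejectStates ω T / requestCount rejectStates ω T) atTop ∂M.processLaw

/-! ### The seven states, named by (actual status, estimate), and the constants -/

def s00 : State := ⟨(.free, .free), by decide⟩
def s10 : State := ⟨(.busy, .free), by decide⟩
def s01 : State := ⟨(.free, .busy), by decide⟩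
def s11 : State := ⟨(.busy, .busy), by decide⟩
def s02 : State := ⟨(.free, .external), by decide⟩
def s12 : State := ⟨(.busy, .external), by decide⟩
def s22 : State := ⟨(.external, .external), by decide⟩

/-- `κ = λ + α + β`. -/
def κ : ℝ := M.lam + M.α + M.β

/-- `β̃ = λβ(λ + β) + γ(λβ + λα + ακ)`. -/
def βt : ℝ :=
  M.lam * M.β * (M.lam + M.β) + M.γ * (M.lam * M.β + M.lam * M.α + M.α * M.κ)

end MarkovMachine

end

/-!
Requests arrive at the rate `λ` whatever the state of the chain, so the number of them that find
the chain in a set of states `A` is asymptotically `λ` times the time spent in `A`. That time is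
compared with the stationary distribution `π` through the Poisson equation `Q h = π f - f`, which is
solvable because the left kernel of `Q` is spanned by `π`: it writes the time integral of `f - π f`
as a telescoping sum of increments of `h` plus a martingale. All martingales that occur have bounded
increments, hence are almost surely `o(n)` after `n` steps, because their increments are orthogonal
in `L²`. Ratios of counts therefore converge almost surely to `π(A) / π(B)`, first along the steps
and then along continuous time, as long waits recur often enough to prevent explosion. The closed
forms follow by solving the balance equations `π Q = 0` explicitly.
-/

open scoped Topology Matrix
open Asymptotics

section AsymptoticsOfSums

variable {E : Type*} [SeminormedAddCommGroup E] {a : ℕ → E} {C : ℝ}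

lemma isLittleO_sum_range_of_isLittleO_sum_range_sq (ha : ∀ n, ‖a n‖ ≤ C)
    (h : (fun n => ∑ k ∈ Finset.range (n ^ 2), a k) =o[atTop] fun n => (n : ℝ) ^ 2) :
    (fun n => ∑ k ∈ Finset.range n, a k) =o[atTop] fun n => (n : ℝ) := by
  have sqrt_atTop : Tendsto Nat.sqrt atTop atTop :=
    tendsto_atTop.2 fun m => (eventually_ge_atTop (m ^ 2)).mono fun n hn => Nat.le_sqrt'.2 hn
  have sq_sqrt_le : (fun n : ℕ => (n.sqrt : ℝ) ^ 2) =O[atTop] fun n => (n : ℝ) :=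
    .of_norm_le fun n => by
      rw [Real.norm_of_nonneg (by positivity)]
      exact_mod_cast n.sqrt_le'
  have up_to_square := (h.comp_tendsto sqrt_atTop).trans_isBigO sq_sqrt_le
  have sqrt_isLittleO : (fun n : ℕ => (n.sqrt : ℝ)) =o[atTop] fun n => (n : ℝ) :=
    (((isLittleO_pow_pow_atTop_of_lt one_lt_two).natCast_atTop (R := ℝ)).comp_tendsto
      sqrt_atTop).congr_left (fun n => by simp) |>.trans_isBigO sq_sqrt_le
  have after_square : (fun n : ℕ => ∑ k ∈ Finset.Ico (n.sqrt ^ 2) n, a k) =O[atTop]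
      fun n : ℕ => (n.sqrt : ℝ) := by
    refine .of_bound (2 * C) (.of_forall fun n => ?_)
    have hC : 0 ≤ C := (norm_nonneg _).trans (ha 0)
    have hn : n - n.sqrt ^ 2 ≤ 2 * n.sqrt := by
      have := n.sqrt_le_add
      rw [sq]
      omega
    calc ‖∑ k ∈ Finset.Ico (n.sqrt ^ 2) n, a k‖
        ≤ ∑ _k ∈ Finset.Ico (n.sqrt ^ 2) n, C := norm_sum_le_of_le _ fun k _ => ha k
      _ = ((n - n.sqrt ^ 2 : ℕ) : ℝ) * C := by simp
      _ ≤ ((2 * n.sqrt : ℕ) : ℝ) * C := by gcongr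
      _ = 2 * C * ‖(n.sqrt : ℝ)‖ := by
        rw [Real.norm_natCast]
        push_cast
        ring
  refine (up_to_square.add (after_square.trans_isLittleO sqrt_isLittleO)).congr_left fun n => ?_
  exact Finset.sum_range_add_sum_Ico a n.sqrt_le'

end AsymptoticsOfSums

lemma tendsto_div_of_isLittleO_sub {ι 𝕜 : Type*} [NormedField 𝕜] {l : Filter ι} {u v : ι → 𝕜}
    {c : 𝕜} (hv : ∀ᶠ i in l, v i ≠ 0) (h : (fun i => u i - c * v i) =o[l] v) :
    Tendsto (fun i => u i / v i) l (𝓝 c) := by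
  have := h.tendsto_div_nhds_zero.add_const c
  rw [zero_add] at this
  refine this.congr' (hv.mono fun i hi => ?_)
  field_simp
  ring

lemma tendsto_div_of_isLittleO_sub_mul {ι 𝕜 : Type*} [NormedField 𝕜] {l : Filter ι}
    {t u v : ι → 𝕜} {a b : 𝕜} (ht : ∀ᶠ i in l, t i ≠ 0) (hb : b ≠ 0)
    (hu : (fun i => u i - a * t i) =o[l] t) (hv : (fun i => v i - b * t i) =o[l] t) :
    Tendsto (fun i => u i / v i) l (𝓝 (a / b)) :=
  ((tendsto_div_of_isLittleO_sub ht hu).div (tendsto_div_of_isLittleO_sub ht hv) hb).congr'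
    (ht.mono fun _ hi => div_div_div_cancel_right₀ hi _ _)

lemma tendsto_atTop_of_isLittleO_sub {u v : ℕ → ℝ} {δ : ℝ} (hδ : 0 < δ)
    (hv : ∀ n : ℕ, δ * n ≤ v n) (h : (fun n => u n - v n) =o[atTop] fun n => (n : ℝ)) :
    Tendsto u atTop atTop := by
  refine tendsto_atTop_mono' _ ?_
    (tendsto_natCast_atTop_atTop.const_mul_atTop (half_pos hδ) : Tendsto _ atTop atTop)
  filter_upwards [h.def (half_pos hδ)] with n hn
  rw [Real.norm_natCast] at hn
  linarith [hv n, neg_abs_le (u n - v n), Real.norm_eq_abs (u n - v n)]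

lemma exists_forall_le_iff_lt_of_monotone {R : Type*} [LinearOrder R] [NoMaxOrder R] {τ : ℕ → R}
    (hτ : Monotone τ) (hτ_top : Tendsto τ atTop atTop) :
    ∃ N : R → ℕ, Tendsto N atTop atTop ∧ ∀ T n, τ n ≤ T ↔ n < N T := by
  have exceeds : ∀ T, ∃ n, T < τ n := fun T => (hτ_top.eventually_gt_atTop T).exists
  have key : ∀ T n, τ n ≤ T ↔ n < Nat.find (exceeds T) := fun T n => by
    rw [Nat.lt_find_iff]
    exact ⟨fun h m hm => not_lt.2 ((hτ hm).trans h), fun h => not_lt.1 (h n le_rfl)⟩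
  refine ⟨fun T => Nat.find (exceeds T), tendsto_atTop.2 fun m => ?_, key⟩
  exact (eventually_ge_atTop (τ m)).mono fun T hT => ((key T m).1 hT).le

section StrongLaw

variable {Ω ι : Type*} [MeasurableSpace Ω] {P : Measure Ω}

lemma integral_sq_sum_of_pairwise_orthogonal {D : ι → Ω → ℝ} {s : Finset ι}
    (hD : ∀ i ∈ s, MemLp (D i) 2 P)
    (horth : (s : Set ι).Pairwise fun i j => ∫ ω, D i ω * D j ω ∂P = 0) :
    ∫ ω, (∑ i ∈ s, D i ω) ^ 2 ∂P = ∑ i ∈ s, ∫ ω, D i ω ^ 2 ∂P := by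
  have hint : ∀ i ∈ s, ∀ j ∈ s, Integrable (fun ω => D i ω * D j ω) P :=
    fun i hi j hj => (hD i hi).integrable_mul (hD j hj)
  simp only [sq, Finset.sum_mul_sum]
  rw [integral_finsetSum s fun i hi => integrable_finsetSum s (hint i hi)]
  refine Finset.sum_congr rfl fun i hi => ?_
  rw [integral_finsetSum s (hint i hi)]
  exact Finset.sum_eq_single_of_mem i hi fun j hj hji => horth hi hj hji.symm

lemma ae_tendsto_zero_of_summable_integral_sq [Countable ι] {f : ι → Ω → ℝ}
    (hf : ∀ i, MemLp (f i) 2 P) (hsum : Summable fun i => ∫ ω, f i ω ^ 2 ∂P) :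
    ∀ᵐ ω ∂P, Tendsto (fun i => f i ω) cofinite (𝓝 0) := by
  have norm_sq : ∀ i ω, ‖f i ω ^ 2‖ = f i ω ^ 2 := fun i ω => Real.norm_of_nonneg (sq_nonneg _)
  have ae_summable : ∀ᵐ ω ∂P, Summable fun i => ‖f i ω ^ 2‖ := by
    refine summable_norm_of_tsum_eLpNorm_ne_top le_rfl
      (fun i => (hf i).integrable_sq.aestronglyMeasurable) ?_
    simp only [eLpNorm_one_eq_lintegral_enorm,
      ← ofReal_integral_norm_eq_lintegral_enorm (hf _).integrable_sq, norm_sq]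
    exact hsum.tsum_ofReal_ne_top
  filter_upwards [ae_summable] with ω hω
  have sq_tendsto := hω.of_norm.tendsto_cofinite_zero.sqrt
  simp only [Real.sqrt_sq_eq_abs, Real.sqrt_zero] at sq_tendsto
  exact (tendsto_zero_iff_abs_tendsto_zero _).2 sq_tendsto

variable [IsFiniteMeasure P] {D : ℕ → Ω → ℝ} {C : ℝ}

lemma ae_isLittleO_sum_range_sq_of_pairwise_orthogonal (hD : ∀ n, AEStronglyMeasurable (D n) P)
    (hC : ∀ n, ∀ᵐ ω ∂P, |D n ω| ≤ C)
    (horth : Pairwise fun i j => ∫ ω, D i ω * D j ω ∂P = 0) :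
    ∀ᵐ ω ∂P, (fun n => ∑ k ∈ Finset.range (n ^ 2), D k ω) =o[atTop] fun n => (n : ℝ) ^ 2 := by
  set S : ℕ → Ω → ℝ := fun n ω => ∑ k ∈ Finset.range n, D k ω
  have memLp_D : ∀ n, MemLp (D n) 2 P := fun n => .of_bound (hD n) C (hC n)
  have memLp_avg : ∀ n : ℕ, MemLp (fun ω => S (n ^ 2) ω / (n : ℝ) ^ 2) 2 P := fun n => by
    simpa only [div_eq_mul_inv] using
      (memLp_finsetSum (Finset.range (n ^ 2)) fun k _ => memLp_D k).mul_const ((n : ℝ) ^ 2)⁻¹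
  have second_moment : ∀ n, ∫ ω, D n ω ^ 2 ∂P ≤ P.real Set.univ * C ^ 2 := fun n => by
    refine (integral_mono_ae (memLp_D n).integrable_sq (integrable_const (C ^ 2)) ?_).trans_eq
      (by simp)
    filter_upwards [hC n] with ω hω
    exact sq_le_sq' (abs_le.1 hω).1 (abs_le.1 hω).2
  have second_moment_avg : ∀ n : ℕ, ∫ ω, (S (n ^ 2) ω / (n : ℝ) ^ 2) ^ 2 ∂P ≤
      P.real Set.univ * C ^ 2 * (1 / (n : ℝ) ^ 2) := fun n => by
    simp only [div_pow]
    rw [integral_div, integral_sq_sum_of_pairwise_orthogonal (fun k _ => memLp_D k)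
      (horth.set_pairwise _)]
    calc (∑ k ∈ Finset.range (n ^ 2), ∫ ω, D k ω ^ 2 ∂P) / ((n : ℝ) ^ 2) ^ 2
        ≤ (∑ _k ∈ Finset.range (n ^ 2), P.real Set.univ * C ^ 2) / ((n : ℝ) ^ 2) ^ 2 := by
          gcongr with k
          exact second_moment k
      _ = P.real Set.univ * C ^ 2 * (1 / (n : ℝ) ^ 2) := by
          rcases eq_or_ne n 0 with rfl | hn
          · simp
          · simp only [Finset.sum_const, Finset.card_range, nsmul_eq_mul, Nat.cast_pow]
            field_simp
  have summable_second_moment : Summable fun n : ℕ => ∫ ω, (S (n ^ 2) ω / (n : ℝ) ^ 2) ^ 2 ∂P :=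
    .of_nonneg_of_le (fun n => integral_nonneg fun ω => sq_nonneg _) second_moment_avg
      ((Real.summable_one_div_nat_pow.2 one_lt_two).mul_left _)
  filter_upwards [ae_tendsto_zero_of_summable_integral_sq memLp_avg summable_second_moment]
    with ω hω
  rw [Nat.cofinite_eq_atTop] at hω
  refine (isLittleO_iff_tendsto fun n hn => ?_).2 hω
  simp [show n = 0 by simpa using hn]

/-- Rajchman's argument: the second moments give convergence along the squares, and bounded terms
cannot move the averages much between consecutive squares. -/
theorem ae_isLittleO_sum_range_of_pairwise_orthogonal (hD : ∀ n, AEStronglyMeasurable (D n) P)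
    (hC : ∀ n, ∀ᵐ ω ∂P, |D n ω| ≤ C)
    (horth : Pairwise fun i j => ∫ ω, D i ω * D j ω ∂P = 0) :
    ∀ᵐ ω ∂P, (fun n => ∑ k ∈ Finset.range n, D k ω) =o[atTop] fun n => (n : ℝ) := by
  filter_upwards [ae_isLittleO_sum_range_sq_of_pairwise_orthogonal hD hC horth,
    ae_all_iff.2 hC] with ω hsq hbound
  exact isLittleO_sum_range_of_isLittleO_sum_range_sq hbound hsq

end StrongLaw

section Trajectories

variable {X : ℕ → Type*} [∀ n, MeasurableSpace (X n)] {μ₀ : Measure (X 0)}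
  {κ : ∀ n, Kernel (∀ i : Finset.Iic n, X i) (X (n + 1))} [∀ n, IsMarkovKernel (κ n)]

lemma map_eval_zero_trajMeasure : (Kernel.trajMeasure μ₀ κ).map (fun ω => ω 0) = μ₀ := by
  have factor : (fun ω : ∀ n, X n => ω 0) =
      (fun past : ∀ i : Finset.Iic 0, X i => past ⟨0, by simp⟩) ∘ Preorder.frestrictLe 0 := rfl
  rw [factor, ← Measure.map_map (by fun_prop) (by fun_prop), Kernel.trajMeasure,
    Measure.map_comp _ _ (by fun_prop), Kernel.traj_map_frestrictLe, Kernel.partialTraj_self,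
    Measure.id_comp]
  exact (Measure.map_map (by fun_prop) (by fun_prop)).trans Measure.map_id

variable [IsProbabilityMeasure μ₀]

lemma ae_trajMeasure_of_forall_ae {n : ℕ} {p : (∀ i : Finset.Iic n, X i) × X (n + 1) → Prop}
    (hp : MeasurableSet {x | p x}) (h : ∀ past, ∀ᵐ x ∂κ n past, p (past, x)) :
    ∀ᵐ ω ∂Kernel.trajMeasure μ₀ κ, p (Preorder.frestrictLe n ω, ω (n + 1)) := by
  have hmap : ∀ᵐ x ∂(Kernel.trajMeasure μ₀ κ).map (Preorder.frestrictLe n) ⊗ₘ κ n, p x :=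
    Measure.ae_compProd_of_ae_ae hp (ae_of_all _ h)
  rw [Kernel.map_frestrictLe_trajMeasure_compProd_eq_map_trajMeasure] at hmap
  exact ae_of_ae_map (by fun_prop) hmap

lemma integral_trajMeasure_past_mul_eq_zero {n : ℕ} {F : (∀ i : Finset.Iic n, X i) → ℝ}
    {d : X (n + 1) → ℝ} {B C : ℝ} (hF : Measurable F) (hd : Measurable d)
    (hB : ∀ past, |F past| ≤ B) (hC : ∀ x, |d x| ≤ C) (hmean : ∀ past, ∫ x, d x ∂κ n past = 0) :
    ∫ ω, F (Preorder.frestrictLe n ω) * d (ω (n + 1)) ∂Kernel.trajMeasure μ₀ κ = 0 := by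
  have hmeas : Measurable fun x : (∀ i : Finset.Iic n, X i) × X (n + 1) => F x.1 * d x.2 :=
    (hF.comp measurable_fst).mul (hd.comp measurable_snd)
  have : IsProbabilityMeasure ((Kernel.trajMeasure μ₀ κ).map (Preorder.frestrictLe n)) :=
    Measure.isProbabilityMeasure_map (by fun_prop)
  have hint : Integrable (fun x : (∀ i : Finset.Iic n, X i) × X (n + 1) => F x.1 * d x.2)
      ((Kernel.trajMeasure μ₀ κ).map (Preorder.frestrictLe n) ⊗ₘ κ n) := by
    refine .of_bound hmeas.aestronglyMeasurable (B * C) (ae_of_all _ fun x => ?_)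
    rw [Real.norm_eq_abs, abs_mul]
    exact mul_le_mul (hB _) (hC _) (abs_nonneg _) ((abs_nonneg _).trans (hB x.1))
  calc ∫ ω, F (Preorder.frestrictLe n ω) * d (ω (n + 1)) ∂Kernel.trajMeasure μ₀ κ
      = ∫ x, F x.1 * d x.2 ∂((Kernel.trajMeasure μ₀ κ).map (Preorder.frestrictLe n) ⊗ₘ κ n) := by
        rw [Kernel.map_frestrictLe_trajMeasure_compProd_eq_map_trajMeasure,
          integral_map (by fun_prop) hmeas.aestronglyMeasurable]
    _ = ∫ past, F past * ∫ x, d x ∂κ n past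
          ∂(Kernel.trajMeasure μ₀ κ).map (Preorder.frestrictLe n) := by
        simp only [Measure.integral_compProd hint, integral_const_mul]
    _ = 0 := by simp only [hmean, mul_zero, integral_zero]

theorem ae_isLittleO_sum_range_trajMeasure {f : ∀ n, X n → ℝ} {C : ℝ}
    (hf : ∀ n, Measurable (f n)) (hC : ∀ n x, |f n x| ≤ C)
    (hmean : ∀ n past, ∫ x, f (n + 1) x ∂κ n past = 0) :
    ∀ᵐ ω ∂Kernel.trajMeasure μ₀ κ,
      (fun n => ∑ k ∈ Finset.range n, f k (ω k)) =o[atTop] fun n => (n : ℝ) := by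
  have orthogonal_of_lt : ∀ i j, i < j →
      ∫ ω, f i (ω i) * f j (ω j) ∂Kernel.trajMeasure μ₀ κ = 0 := fun i j hij => by
    obtain ⟨n, rfl⟩ := Nat.exists_eq_add_of_lt hij
    exact integral_trajMeasure_past_mul_eq_zero
      (F := fun past => f i (past ⟨i, Finset.mem_Iic.2 (i.le_add_right n)⟩))
      ((hf i).comp (measurable_pi_apply _)) (hf _) (fun _ => hC i _) (hC _) (hmean _)
  refine ae_isLittleO_sum_range_of_pairwise_orthogonal
    (fun n => ((hf n).comp (measurable_pi_apply n)).aestronglyMeasurable)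
    (fun n => ae_of_all _ fun ω => hC n (ω n)) fun i j hij => ?_
  rcases hij.lt_or_gt with h | h
  · exact orthogonal_of_lt i j h
  · simpa only [mul_comm] using orthogonal_of_lt j i h

end Trajectories

lemma exists_mulVec_eq_of_forall_vecMul_eq_zero {m n K : Type*} [Fintype m] [Fintype n] [Field K]
    (A : Matrix m n K) (g : m → K) (hg : ∀ v, v ᵥ* A = 0 → v ⬝ᵥ g = 0) : ∃ h, A *ᵥ h = g := by
  classical
  by_contra! hne
  have notMem_range : g ∉ LinearMap.range A.mulVecLin := fun ⟨h, hh⟩ => hne h hh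
  obtain ⟨φ, hφ, range_le_ker⟩ := Submodule.exists_le_ker_of_notMem notMem_range
  obtain ⟨v, rfl⟩ := (dotProductEquiv K m).surjective φ
  refine hφ (hg v (dotProduct_eq_zero _ fun h => ?_))
  rw [← Matrix.dotProduct_mulVec]
  exact range_le_ker ⟨h, rfl⟩

namespace MarkovMachine

lemma forall_state {p : State → Prop} :
    (∀ y, p y) ↔ p s00 ∧ p s10 ∧ p s01 ∧ p s11 ∧ p s02 ∧ p s12 ∧ p s22 := by
  refine ⟨fun h => ⟨h _, h _, h _, h _, h _, h _, h _⟩, fun h y => ?_⟩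
  have cases_state : ∀ y : State, y = s00 ∨ y = s10 ∨ y = s01 ∨ y = s11 ∨ y = s02 ∨ y = s12 ∨
    y = s22 := by decide
  rcases cases_state y with rfl | rfl | rfl | rfl | rfl | rfl | rfl <;> tauto

lemma sum_state (f : State → ℝ) :
    ∑ y, f y = f s00 + f s10 + f s01 + f s11 + f s02 + f s12 + f s22 := by
  have univ_eq : (Finset.univ : Finset State) =
    {s00} ∪ {s10} ∪ {s01} ∪ {s11} ∪ {s02} ∪ {s12} ∪ {s22} := by decide
  rw [univ_eq]
  repeat rw [Finset.sum_union (by decide)]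
  simp only [Finset.sum_singleton]

lemma sum_event (f : Event → ℝ) :
    ∑ e, f e = f .internalArrival + f .internalCompletion + f .externalCompletion + f .sample +
      f .request := by
  have univ_eq : (Finset.univ : Finset Event) = {.internalArrival} ∪ {.internalCompletion} ∪
    {.externalCompletion} ∪ {.sample} ∪ {.request} := by decide
  rw [univ_eq]
  repeat rw [Finset.sum_union (by decide)]
  simp only [Finset.sum_singleton]

variable (M : MarkovMachine)

lemma rates_pos : 0 < M.α ∧ 0 < M.β ∧ 0 < M.γ ∧ 0 < M.lam ∧ 0 < M.μ :=
  ⟨M.α_pos, M.β_pos, M.γ_pos, M.lam_pos, M.μ_pos⟩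

lemma generator_apply (i j : State) :
    M.generator i j =
      ∑ e, M.rate i e * ((if move i e = j then 1 else 0) - if i = j then 1 else 0) := by
  by_cases hij : i = j
  · subst hij
    rw [generator, if_pos rfl, Finset.sum_erase_eq_sub (Finset.mem_univ _), Finset.sum_comm]
    simp [mul_sub]
  · simp [generator, hij]

lemma generator_mulVec (h : State → ℝ) (y : State) :
    (M.generator *ᵥ h) y = ∑ e, M.rate y e * (h (move y e) - h y) := by
  simp only [Matrix.mulVec, dotProduct, generator_apply, Finset.sum_mul]
  rw [Finset.sum_comm]
  simp [mul_assoc, sub_mul, ← Finset.mul_sum]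

lemma vecMul_generator_eq_zero_iff {v : State → ℝ} :
    v ᵥ* M.generator = 0 ↔
      (M.α + M.lam) * v s00 = M.β * v s10 + M.μ * (v s01 + v s02) ∧
      (M.β + M.μ + M.lam) * v s10 = M.α * v s00 ∧
      (M.α + M.μ) * v s01 = M.β * v s11 ∧
      M.β * v s11 = (M.μ + M.lam) * v s10 + M.α * v s01 + M.μ * v s12 ∧
      (M.α + M.μ) * v s02 = M.β * v s12 + M.γ * v s22 ∧
      (M.β + M.μ) * v s12 = M.α * v s02 ∧
      M.γ * v s22 = M.lam * v s00 := by
  have net_flow : ∀ j, (v ᵥ* M.generator) j = ∑ i, v i *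
      ∑ e, M.rate i e * ((if move i e = j then 1 else 0) - if i = j then 1 else 0) := fun j => by
    simp only [Matrix.vecMul, dotProduct, generator_apply]
  simp only [funext_iff, forall_state, net_flow, sum_state, sum_event, rate, State.machine, move,
    movePair, s00, s10, s01, s11, s02, s12, s22, Subtype.mk.injEq, Prod.mk.injEq, reduceCtorEq,
    and_true, and_false, if_true, if_false, Pi.zero_apply]
  repeat' apply and_congr
  all_goals exact ⟨fun h => by linear_combination -h, fun h => by linear_combination -h⟩

/-- The solution of the balance equations with value `1` at `s00`. -/
noncomputable def weight (y : State) : ℝ :=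
  match y.1 with
  | (.free, .free) => 1
  | (.busy, .free) => M.α / (M.β + M.μ + M.lam)
  | (.free, .external) => M.lam * (M.β + M.μ) / (M.μ * (M.α + M.β + M.μ))
  | (.busy, .external) => M.lam * M.α / (M.μ * (M.α + M.β + M.μ))
  | (.free, .busy) => (M.μ + M.lam) * M.α / (M.μ * (M.β + M.μ + M.lam)) +
      M.lam * M.α / (M.μ * (M.α + M.β + M.μ))
  | (.busy, .busy) => (M.α + M.μ) / M.β * ((M.μ + M.lam) * M.α / (M.μ * (M.β + M.μ + M.lam)) +
      M.lam * M.α / (M.μ * (M.α + M.β + M.μ)))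
  | (.external, _) => M.lam / M.γ

lemma weight_pos (y : State) : 0 < M.weight y := by
  obtain ⟨hα, hβ, hγ, hlam, hμ⟩ := M.rates_pos
  unfold weight
  split <;> positivity

lemma sum_weight_pos : 0 < ∑ y, M.weight y :=
  Finset.sum_pos (fun y _ => M.weight_pos y) ⟨s00, Finset.mem_univ _⟩

lemma weight_vecMul_generator : M.weight ᵥ* M.generator = 0 := by
  obtain ⟨hα, hβ, hγ, hlam, hμ⟩ := M.rates_pos
  rw [vecMul_generator_eq_zero_iff]
  simp only [weight, s00, s10, s01, s11, s02, s12, s22]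
  refine ⟨?_, ?_, ?_, ?_, ?_, ?_, ?_⟩ <;> field_simp <;> ring

variable {M}

lemma eq_smul_weight {v : State → ℝ} (hv : v ᵥ* M.generator = 0) : v = v s00 • M.weight := by
  obtain ⟨hα, hβ, hγ, hlam, hμ⟩ := M.rates_pos
  obtain ⟨-, h10, h01, h11, h02, h12, h22⟩ := M.vecMul_generator_eq_zero_iff.1 hv
  have v10 : v s10 = v s00 * (M.α / (M.β + M.μ + M.lam)) := by
    field_simp
    linear_combination h10
  have v22 : v s22 = v s00 * (M.lam / M.γ) := by
    field_simp
    linear_combination h22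
  have v02 : v s02 = v s00 * (M.lam * (M.β + M.μ) / (M.μ * (M.α + M.β + M.μ))) := by
    field_simp
    linear_combination (M.β + M.μ) * h02 + M.β * h12 + (M.β + M.μ) * h22
  have v12 : v s12 = v s00 * (M.lam * M.α / (M.μ * (M.α + M.β + M.μ))) := by
    field_simp
    linear_combination M.α * h02 + (M.α + M.μ) * h12 + M.α * h22
  have v01 : v s01 = v s00 * ((M.μ + M.lam) * M.α / (M.μ * (M.β + M.μ + M.lam)) +
      M.lam * M.α / (M.μ * (M.α + M.β + M.μ))) :=
    calc v s01 = (M.μ + M.lam) / M.μ * v s10 + v s12 := by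
          field_simp
          linear_combination h01 + h11
      _ = _ := by
          rw [v10, v12]
          field_simp
  have v11 : v s11 = v s00 * ((M.α + M.μ) / M.β *
      ((M.μ + M.lam) * M.α / (M.μ * (M.β + M.μ + M.lam)) +
        M.lam * M.α / (M.μ * (M.α + M.β + M.μ)))) := by
    rw [mul_left_comm, ← v01]
    field_simp
    linear_combination -h01
  exact funext (forall_state.2 ⟨(mul_one _).symm, v10, v01, v11, v02, v12, v22⟩)

variable (M)

/-- The stationary distribution of the chain. -/
noncomputable def stationary : State → ℝ := (∑ y, M.weight y)⁻¹ • M.weight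

lemma stationary_pos (y : State) : 0 < M.stationary y :=
  mul_pos (inv_pos.2 M.sum_weight_pos) (M.weight_pos y)

lemma sum_stationary : ∑ y, M.stationary y = 1 := by
  simp only [stationary, Pi.smul_apply, ← Finset.smul_sum]
  exact inv_mul_cancel₀ M.sum_weight_pos.ne'

lemma isStationary_stationary : M.IsStationary M.stationary := by
  refine ⟨fun y => (M.stationary_pos y).le, M.sum_stationary, ?_⟩
  rw [stationary, Matrix.smul_vecMul, weight_vecMul_generator, smul_zero]

variable {M}

lemma eq_sum_smul_stationary {v : State → ℝ} (hv : v ᵥ* M.generator = 0) :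
    v = (∑ y, v y) • M.stationary := by
  have hsum : ∑ y, v y = v s00 * ∑ y, M.weight y := by
    rw [Finset.mul_sum]
    exact Finset.sum_congr rfl fun y _ => congrFun (eq_smul_weight hv) y
  rw [hsum, stationary, smul_smul, mul_inv_cancel_right₀ M.sum_weight_pos.ne']
  exact eq_smul_weight hv

lemma IsStationary.eq_stationary {p : State → ℝ} (hp : M.IsStationary p) : p = M.stationary := by
  rw [eq_sum_smul_stationary hp.2.2, hp.2.1, one_smul]

variable (M)

lemma exists_poisson_solution (f : State → ℝ) :
    ∃ h, M.generator *ᵥ h = fun y => M.stationary ⬝ᵥ f - f y := by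
  refine exists_mulVec_eq_of_forall_vecMul_eq_zero _ _ fun v hv => ?_
  have stationary_orthogonal : M.stationary ⬝ᵥ (fun y => M.stationary ⬝ᵥ f - f y) = 0 := by
    have := M.sum_stationary
    simp only [dotProduct, mul_sub, Finset.sum_sub_distrib, ← Finset.sum_mul, this]
    ring
  rw [eq_sum_smul_stationary hv, smul_dotProduct, stationary_orthogonal, smul_zero]

lemma stationary_falseAccept_ratio :
    M.stationary s10 / (M.stationary s10 + M.stationary s00) = M.α / (M.μ + M.κ) := by
  obtain ⟨hα, hβ, -, hlam, hμ⟩ := M.rates_pos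
  simp only [stationary, Pi.smul_apply, smul_eq_mul, ← mul_add]
  rw [mul_div_mul_left _ _ (inv_pos.2 M.sum_weight_pos).ne']
  simp only [weight, s00, s10, κ]
  field_simp
  ring

lemma stationary_falseReject_ratio :
    (M.stationary s02 + M.stationary s01) / (M.stationary s02 + M.stationary s01 +
      M.stationary s12 + M.stationary s11 + M.stationary s22) =
      M.γ * M.β * (M.μ * (M.lam + M.α) + M.lam * M.κ) /
        ((M.α * M.γ + M.lam * M.β) * M.μ ^ 2 + M.βt * M.μ +
          M.γ * M.lam * (M.β + M.α) * M.κ) := by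
  obtain ⟨hα, hβ, hγ, hlam, hμ⟩ := M.rates_pos
  simp only [stationary, Pi.smul_apply, smul_eq_mul, ← mul_add]
  rw [mul_div_mul_left _ _ (inv_pos.2 M.sum_weight_pos).ne']
  simp only [weight, s01, s02, s11, s12, s22, κ, βt]
  rw [div_eq_div_iff (by positivity) (by positivity)]
  field_simp
  ring

instance : IsProbabilityMeasure M.processLaw := by
  unfold processLaw
  infer_instance

lemma ae_stepLaw_state (y : State) : ∀ᵐ s ∂M.stepLaw y, s.1 = y := by
  have hmeas : MeasurableSet {s : Step | s.1 = y} :=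
    (measurableSet_singleton y).preimage measurable_fst
  rw [stepLaw, Measure.dirac_prod, ae_map_iff (by fun_prop) hmeas]
  exact ae_of_all _ fun _ => rfl

lemma integral_stepLaw_state (y : State) (f : State → ℝ) : ∫ s, f s.1 ∂M.stepLaw y = f y := by
  rw [integral_congr_ae ((M.ae_stepLaw_state y).mono fun s hs => congrArg f hs)]
  simp

lemma map_event_stepLaw (y : State) : (M.stepLaw y).map (fun s => s.2.1) = M.eventLaw y := by
  change (M.stepLaw y).map (Prod.fst ∘ Prod.snd) = M.eventLaw y
  rw [← Measure.map_map measurable_fst measurable_snd, stepLaw, Measure.map_snd_prod,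
    measure_univ, one_smul, Measure.map_fst_prod, measure_univ, one_smul]

lemma map_wait_stepLaw (y : State) :
    (M.stepLaw y).map (fun s => s.2.2) = expMeasure (M.totalRate y) := by
  change (M.stepLaw y).map (Prod.snd ∘ Prod.snd) = expMeasure (M.totalRate y)
  rw [← Measure.map_map measurable_snd measurable_snd, stepLaw, Measure.map_snd_prod,
    measure_univ, one_smul, Measure.map_snd_prod, measure_univ, one_smul]

lemma integral_stepLaw_event (y : State) (G : State → Event → ℝ) :
    ∫ s, G s.1 s.2.1 ∂M.stepLaw y = (∑ e, M.rate y e * G y e) / M.totalRate y :=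
  calc ∫ s, G s.1 s.2.1 ∂M.stepLaw y
      = ∫ s, G y s.2.1 ∂M.stepLaw y :=
        integral_congr_ae ((M.ae_stepLaw_state y).mono fun s hs => by simp only [hs])
    _ = ∫ e, G y e ∂M.eventLaw y := by
        rw [← map_event_stepLaw, integral_map (by fun_prop)
          (measurable_of_countable _).aestronglyMeasurable]
    _ = ∑ e, M.rate y e / M.totalRate y * G y e := by
        rw [eventLaw, integral_finsetSum_measure fun e _ =>
          (integrable_dirac (by simp)).smul_measure ENNReal.ofReal_ne_top]
        refine Finset.sum_congr rfl fun e _ => ?_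
        rw [integral_smul_measure, integral_dirac, ENNReal.toReal_ofReal
          (div_nonneg (M.rate_nonneg y e) (M.totalRate_pos y).le), smul_eq_mul]
    _ = (∑ e, M.rate y e * G y e) / M.totalRate y := by
        simp only [Finset.sum_div, div_mul_eq_mul_div]

lemma ae_stepLaw_wait_nonneg (y : State) : ∀ᵐ s ∂M.stepLaw y, 0 ≤ s.2.2 := by
  refine ae_of_ae_map (f := fun s : Step => s.2.2) (by fun_prop) ?_
  have measurable_pdf : Measurable (gammaPDF 1 (M.totalRate y)) :=
    (measurable_gammaPDFReal 1 _).ennreal_ofReal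
  rw [map_wait_stepLaw, expMeasure, gammaMeasure, ae_withDensity_iff measurable_pdf]
  refine ae_of_all _ fun w hw => ?_
  contrapose! hw
  exact gammaPDF_of_neg hw

lemma stepLaw_wait_gt_one_pos (y : State) : 0 < (M.stepLaw y).real {s | 1 < s.2.2} := by
  have cdf_one := cdf_expMeasure_eq (M.totalRate_pos y) 1
  rw [if_pos zero_le_one, cdf_eq_real] at cdf_one
  have tail : (M.stepLaw y).real {s | 1 < s.2.2} =
      (expMeasure (M.totalRate y)).real (Set.Iic 1)ᶜ := by
    rw [← map_wait_stepLaw, map_measureReal_apply (by fun_prop) measurableSet_Iic.compl,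
      Set.compl_Iic]
    rfl
  rw [tail, probReal_compl_eq_one_sub measurableSet_Iic, cdf_one]
  simpa using Real.exp_pos _

lemma ae_processLaw_forall {p : Step → Prop} (hp : MeasurableSet {s | p s})
    (h : ∀ y, ∀ᵐ s ∂M.stepLaw y, p s) : ∀ᵐ ω ∂M.processLaw, ∀ n, p (ω n) := by
  rw [ae_all_iff]
  rintro (_ | n)
  · have hmap : M.processLaw.map (fun ω => ω 0) = M.stepLaw initial := map_eval_zero_trajMeasure
    exact ae_of_ae_map (measurable_pi_apply 0).aemeasurable (hmap ▸ h initial)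
  · exact ae_trajMeasure_of_forall_ae (X := fun _ => Step) (p := fun x => p x.2)
      (hp.preimage measurable_snd) fun past => h (nextState n past)

lemma ae_state_succ :
    ∀ᵐ ω ∂M.processLaw, ∀ n, (ω (n + 1)).1 = move (ω n).1 (ω n).2.1 := by
  refine ae_all_iff.2 fun n => ?_
  exact ae_trajMeasure_of_forall_ae (X := fun _ => Step) (p := fun x => x.2.1 = nextState n x.1)
    (measurableSet_eq_fun (by fun_prop) ((measurable_nextState n).comp measurable_fst))
    fun past => M.ae_stepLaw_state (nextState n past)

lemma ae_sum_step_sub_mean_isLittleO {G : Step → ℝ} {C : ℝ} (hG : Measurable G)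
    (hC : ∀ s, |G s| ≤ C) :
    ∀ᵐ ω ∂M.processLaw, (fun n => ∑ k ∈ Finset.range n, G (ω k) -
      ∑ k ∈ Finset.range n, ∫ s, G s ∂M.stepLaw (ω k).1) =o[atTop] fun n => (n : ℝ) := by
  set mean : State → ℝ := fun y => ∫ s, G s ∂M.stepLaw y
  have measurable_mean : Measurable fun s : Step => mean s.1 :=
    (measurable_of_countable mean).comp measurable_fst
  have abs_mean_le : ∀ y, |mean y| ≤ C := fun y => by
    simpa using norm_integral_le_of_norm_le_const (μ := M.stepLaw y) (f := G) (ae_of_all _ hC)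
  have centered : ∀ y, ∫ s, (G s - mean s.1) ∂M.stepLaw y = 0 := fun y => by
    rw [integral_sub (.of_bound hG.aestronglyMeasurable C (ae_of_all _ hC))
      (.of_bound measurable_mean.aestronglyMeasurable C (ae_of_all _ fun s => abs_mean_le _)),
      integral_stepLaw_state]
    exact sub_self _
  simp only [← Finset.sum_sub_distrib]
  exact ae_isLittleO_sum_range_trajMeasure (X := fun _ => Step)
    (f := fun _ s => G s - mean s.1) (C := C + C) (fun _ => hG.sub measurable_mean)
    (fun _ s => (abs_sub _ _).trans (add_le_add (hC s) (abs_mean_le _)))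
    fun n past => centered (nextState n past)

lemma ae_sum_event_sub_mean_isLittleO (G : State → Event → ℝ) :
    ∀ᵐ ω ∂M.processLaw, (fun n => ∑ k ∈ Finset.range n, G (ω k).1 (ω k).2.1 -
      ∑ k ∈ Finset.range n, (∑ e, M.rate (ω k).1 e * G (ω k).1 e) / M.totalRate (ω k).1)
        =o[atTop] fun n => (n : ℝ) := by
  obtain ⟨C, hC⟩ := Finite.exists_le fun p : State × Event => |G p.1 p.2|
  have hG : Measurable fun s : Step => G s.1 s.2.1 :=
    (measurable_of_countable fun p : State × Event => G p.1 p.2).comp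
      (by fun_prop : Measurable fun s : Step => (s.1, s.2.1))
  simpa only [integral_stepLaw_event] using
    M.ae_sum_step_sub_mean_isLittleO hG fun s => hC (s.1, s.2.1)

/-- The time integral of `f` along the first `n` steps, with each waiting time replaced by its mean
given the state: this is what the counts of events are compared with. -/
noncomputable def meanTimeIntegral (f : State → ℝ) (ω : ℕ → Step) (n : ℕ) : ℝ :=
  ∑ k ∈ Finset.range n, f (ω k).1 / M.totalRate (ω k).1

/-- The number of requests among the first `n` steps that arrive while the state is in `A`. -/
noncomputable def stepCount (A : Set State) (ω : ℕ → Step) (n : ℕ) : ℝ :=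
  ∑ k ∈ Finset.range n, if (ω k).2.1 = Event.request then A.indicator 1 (ω k).1 else 0

/-- The stationary probability of a set of states. -/
noncomputable def stationaryProb (A : Set State) : ℝ := M.stationary ⬝ᵥ A.indicator 1

lemma ae_meanTimeIntegral_generator_mulVec_isLittleO (h : State → ℝ) :
    ∀ᵐ ω ∂M.processLaw, M.meanTimeIntegral (M.generator *ᵥ h) ω =o[atTop] fun n => (n : ℝ) := by
  obtain ⟨B, hB⟩ := Finite.exists_le fun y => ‖h y‖
  filter_upwards [M.ae_sum_event_sub_mean_isLittleO fun y e => h (move y e) - h y,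
    M.ae_state_succ] with ω martingale state_succ
  have telescope : ∀ n, ∑ k ∈ Finset.range n, (h (move (ω k).1 (ω k).2.1) - h (ω k).1) =
      h (ω n).1 - h (ω 0).1 := fun n => by
    simp only [← state_succ]
    exact Finset.sum_range_sub (fun k => h (ω k).1) n
  have increment_isLittleO : (fun n => h (ω n).1 - h (ω 0).1) =o[atTop] fun n => (n : ℝ) := by
    have increment_isBigO : (fun n => h (ω n).1 - h (ω 0).1) =O[atTop] fun _ => (1 : ℝ) :=
      .of_bound (B + B) (.of_forall fun n => by
        simpa using (norm_sub_le _ _).trans (add_le_add (hB (ω n).1) (hB (ω 0).1)))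
    exact increment_isBigO.trans_isLittleO
      (isLittleO_const_left.2 (.inr (tendsto_norm_atTop_atTop.comp tendsto_natCast_atTop_atTop)))
  simp only [telescope, ← generator_mulVec] at martingale
  exact (increment_isLittleO.sub martingale).congr_left fun n => by
    rw [sub_sub_cancel, meanTimeIntegral]

lemma ae_meanTimeIntegral_sub_isLittleO (f : State → ℝ) :
    ∀ᵐ ω ∂M.processLaw, (fun n => M.meanTimeIntegral f ω n -
      (M.stationary ⬝ᵥ f) * M.meanTimeIntegral 1 ω n) =o[atTop] fun n => (n : ℝ) := by
  obtain ⟨h, hh⟩ := M.exists_poisson_solution f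
  filter_upwards [M.ae_meanTimeIntegral_generator_mulVec_isLittleO h] with ω hω
  refine hω.neg_left.congr_left fun n => ?_
  simp only [hh, meanTimeIntegral, sub_div, Finset.sum_sub_distrib, neg_sub, Finset.mul_sum,
    Pi.one_apply, mul_one_div]

lemma ae_stepCount_sub_meanTimeIntegral_isLittleO (A : Set State) :
    ∀ᵐ ω ∂M.processLaw, (fun n => stepCount A ω n -
      M.lam * M.meanTimeIntegral (A.indicator 1) ω n) =o[atTop] fun n => (n : ℝ) := by
  filter_upwards [M.ae_sum_event_sub_mean_isLittleO fun y e =>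
    if e = Event.request then A.indicator 1 y else 0] with ω hω
  simpa [stepCount, meanTimeIntegral, rate, Finset.mul_sum, mul_div_assoc] using hω

lemma ae_stepCount_sub_isLittleO (A : Set State) :
    ∀ᵐ ω ∂M.processLaw, (fun n => stepCount A ω n -
      M.lam * M.stationaryProb A * M.meanTimeIntegral 1 ω n) =o[atTop] fun n => (n : ℝ) := by
  filter_upwards [M.ae_stepCount_sub_meanTimeIntegral_isLittleO A,
    M.ae_meanTimeIntegral_sub_isLittleO (A.indicator 1)] with ω arrivals time
  refine (arrivals.add (time.const_mul_left M.lam)).congr_left fun n => ?_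
  rw [stationaryProb]
  ring

lemma exists_pos_forall_mul_le_sum_range {f : State → ℝ} (hf : ∀ y, 0 < f y) :
    ∃ δ > 0, ∀ (ω : ℕ → Step) (n : ℕ), δ * n ≤ ∑ k ∈ Finset.range n, f (ω k).1 := by
  have : Nonempty State := ⟨initial⟩
  obtain ⟨y, hy⟩ := Finite.exists_min f
  refine ⟨f y, hf y, fun ω n => ?_⟩
  simpa [mul_comm] using
    Finset.card_nsmul_le_sum (Finset.range n) (fun k => f (ω k).1) (f y) fun k _ => hy _

lemma ae_tendsto_stepCount_ratio (A : Set State) {B : Set State} (hB : M.stationaryProb B ≠ 0) :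
    ∀ᵐ ω ∂M.processLaw, Tendsto (fun n => stepCount A ω n / stepCount B ω n) atTop
      (𝓝 (M.stationaryProb A / M.stationaryProb B)) := by
  obtain ⟨δ, hδ, mul_le_time⟩ := exists_pos_forall_mul_le_sum_range
    (f := fun y => 1 / M.totalRate y) fun y => one_div_pos.2 (M.totalRate_pos y)
  filter_upwards [M.ae_stepCount_sub_isLittleO A, M.ae_stepCount_sub_isLittleO B] with ω hA hB'
  have natCast_isBigO : (fun n : ℕ => (n : ℝ)) =O[atTop] M.meanTimeIntegral 1 ω := by
    refine .of_bound δ⁻¹ (.of_forall fun n => ?_)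
    rw [Real.norm_natCast, ← div_eq_inv_mul, le_div_iff₀' hδ]
    exact (mul_le_time ω n).trans (le_abs_self _)
  have time_ne_zero : ∀ᶠ n in atTop, M.meanTimeIntegral 1 ω n ≠ 0 := by
    filter_upwards [eventually_gt_atTop 0] with n hn
    exact ((mul_pos hδ (Nat.cast_pos.2 hn)).trans_le (mul_le_time ω n)).ne'
  rw [← mul_div_mul_left _ _ M.lam_pos.ne']
  exact tendsto_div_of_isLittleO_sub_mul time_ne_zero (mul_ne_zero M.lam_pos.ne' hB)
    (hA.trans_isBigO natCast_isBigO) (hB'.trans_isBigO natCast_isBigO)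

lemma ae_wait_nonneg : ∀ᵐ ω ∂M.processLaw, ∀ n, 0 ≤ (ω n).2.2 :=
  M.ae_processLaw_forall (p := fun s => 0 ≤ s.2.2)
    (measurableSet_le measurable_const measurable_snd.snd) M.ae_stepLaw_wait_nonneg

lemma ae_monotone_eventTime : ∀ᵐ ω ∂M.processLaw, Monotone (eventTime ω) := by
  filter_upwards [M.ae_wait_nonneg] with ω wait_nonneg
  refine monotone_nat_of_le_succ fun n => ?_
  rw [eventTime, eventTime, Finset.sum_range_succ _ (n + 1)]
  exact le_add_of_nonneg_right (wait_nonneg (n + 1))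

lemma ae_tendsto_eventTime_atTop : ∀ᵐ ω ∂M.processLaw, Tendsto (eventTime ω) atTop atTop := by
  have hmeas : MeasurableSet {s : Step | 1 < s.2.2} :=
    measurableSet_lt measurable_const (by fun_prop)
  set longWait : Step → ℝ := {s : Step | 1 < s.2.2}.indicator 1
  obtain ⟨δ, hδ, mul_le_mean⟩ := exists_pos_forall_mul_le_sum_range M.stepLaw_wait_gt_one_pos
  have longWait_law := M.ae_sum_step_sub_mean_isLittleO (G := longWait) (C := 1)
    (measurable_one.indicator hmeas) fun s => by
      by_cases hs : 1 < s.2.2 <;> simp [longWait, hs]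
  simp only [longWait, integral_indicator_one hmeas] at longWait_law
  filter_upwards [M.ae_wait_nonneg, longWait_law] with ω wait_nonneg hω
  have wait_sum_tendsto : Tendsto (fun n => ∑ k ∈ Finset.range n, (ω k).2.2) atTop atTop := by
    refine tendsto_atTop_mono (fun n => Finset.sum_le_sum fun k _ => ?_)
      (tendsto_atTop_of_isLittleO_sub hδ (mul_le_mean ω) hω)
    by_cases hk : 1 < (ω k).2.2
    · simpa [hk] using hk.le
    · simpa [hk] using wait_nonneg k
  exact wait_sum_tendsto.comp (tendsto_add_atTop_nat 1)

lemma requestCount_eq_stepCount {ω : ℕ → Step} {T : ℝ} {n : ℕ}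
    (hn : ∀ k, eventTime ω k ≤ T ↔ k < n) (A : Set State) :
    requestCount A ω T = stepCount A ω n := by
  classical
  have counted : {k : ℕ | eventTime ω k ≤ T ∧ (ω k).2.1 = Event.request ∧ (ω k).1 ∈ A} =
      ((Finset.range n).filter fun k => (ω k).2.1 = Event.request ∧ (ω k).1 ∈ A : Finset ℕ) := by
    ext k
    simp [hn]
  rw [requestCount, counted, Set.ncard_coe_finset, Finset.card_filter, stepCount]
  simp [Set.indicator_apply, ite_and]

lemma ae_tendsto_requestCount_ratio (A : Set State) {B : Set State}
    (hB : M.stationaryProb B ≠ 0) :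
    ∀ᵐ ω ∂M.processLaw, Tendsto (fun T => requestCount A ω T / requestCount B ω T) atTop
      (𝓝 (M.stationaryProb A / M.stationaryProb B)) := by
  filter_upwards [M.ae_tendsto_stepCount_ratio A hB, M.ae_monotone_eventTime,
    M.ae_tendsto_eventTime_atTop] with ω ratio_tendsto monotone tendsto_top
  obtain ⟨N, N_tendsto, hN⟩ := exists_forall_le_iff_lt_of_monotone monotone tendsto_top
  simp only [requestCount_eq_stepCount (hN _)]
  exact ratio_tendsto.comp N_tendsto

lemma integral_limsup_requestCount_ratio (A : Set State) {B : Set State}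
    (hB : M.stationaryProb B ≠ 0) :
    ∫ ω, limsup (fun T : ℝ => requestCount A ω T / requestCount B ω T) atTop ∂M.processLaw =
      M.stationaryProb A / M.stationaryProb B := by
  rw [integral_congr_ae ((M.ae_tendsto_requestCount_ratio A hB).mono fun ω hω => hω.limsup_eq)]
  simp

lemma FAR_eq : M.FAR = M.stationary s10 / (M.stationary s10 + M.stationary s00) := by
  have accept : M.stationaryProb acceptStates = M.stationary s10 + M.stationary s00 := by
    simp [stationaryProb, dotProduct, sum_state, acceptStates, State.estimate, s00, s10, s01, s11,
      s02, s12, s22, add_comm]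
  have falseAccept : M.stationaryProb falseAcceptStates = M.stationary s10 := by
    simp [stationaryProb, dotProduct, sum_state, falseAcceptStates, State.estimate, State.machine,
      s00, s10, s01, s11, s02, s12, s22]
  have accept_pos := add_pos (M.stationary_pos s10) (M.stationary_pos s00)
  rw [FAR, integral_limsup_requestCount_ratio _ _ (accept ▸ accept_pos.ne'), accept, falseAccept]

lemma FRR_eq :
    M.FRR = (M.stationary s02 + M.stationary s01) / (M.stationary s02 + M.stationary s01 +
      M.stationary s12 + M.stationary s11 + M.stationary s22) := by
  have reject : M.stationaryProb rejectStates = M.stationary s02 + M.stationary s01 +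
      M.stationary s12 + M.stationary s11 + M.stationary s22 := by
    simp [stationaryProb, dotProduct, sum_state, rejectStates, State.estimate, s00, s10, s01, s11,
      s02, s12, s22]
    ring
  have falseReject : M.stationaryProb falseRejectStates = M.stationary s02 + M.stationary s01 := by
    simp [stationaryProb, dotProduct, sum_state, falseRejectStates, State.estimate, State.machine,
      s00, s10, s01, s11, s02, s12, s22, add_comm]
  have reject_pos : 0 < M.stationaryProb rejectStates := by
    have pos := M.stationary_pos
    linarith [pos s02, pos s01, pos s12, pos s11, pos s22]
  rw [FRR, integral_limsup_requestCount_ratio _ _ reject_pos.ne', reject, falseReject]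

end MarkovMachine

theorem mainTheorem3 (M : MarkovMachine) :
    ∃ π : MarkovMachine.State → ℝ,
      M.IsStationary π ∧ (∀ π', M.IsStationary π' → π' = π) ∧
      M.FAR = π MarkovMachine.s10 / (π MarkovMachine.s10 + π MarkovMachine.s00) ∧
      M.FAR = M.α / (M.μ + M.κ) ∧
      M.FRR = (π MarkovMachine.s02 + π MarkovMachine.s01) /
        (π MarkovMachine.s02 + π MarkovMachine.s01 + π MarkovMachine.s12 +
          π MarkovMachine.s11 + π MarkovMachine.s22) ∧
      M.FRR = M.γ * M.β * (M.μ * (M.lam + M.α) + M.lam * M.κ) /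
        ((M.α * M.γ + M.lam * M.β) * M.μ ^ 2 + M.βt * M.μ +
          M.γ * M.lam * (M.β + M.α) * M.κ) :=
  ⟨M.stationary, M.isStationary_stationary, fun _ h => h.eq_stationary, M.FAR_eq,
    M.FAR_eq.trans M.stationary_falseAccept_ratio, M.FRR_eq,
    M.FRR_eq.trans M.stationary_falseReject_ratio⟩
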